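/- For $n\ge 1$ let $$\alpha(n;k_1,\ldots,k_n)=\Bigl(\prod_{1\le p<q\le n}\bigl(\mathrm{id}+E_{k_p}\Delta_{k_q}\bigr)\Bigr)\prod_{1\le i<j\le n}\frac{k_j-k_i}{j-i},$$ where $E_x$ is the shift operator $E_x\,p(x)=p(x+1)$, $\Delta_x=E_x-\mathrm{id}$ is the difference operator, and the product of the (commuting) operators is their composition. This is a polynomial in $k_1,\ldots,k_n$ over $\mathbb{Q}$. (It extends, to arbitrary $(k_1,\ldots,k_n)\in\mathbb{Z}^n$, the number of monotone triangles with $n$ rows and bottom row $(k_1,\ldots,k_n)$.) Then for every $n\ge 1$ and all $(k_1,\ldots,k_n)\in\mathbb{Z}^n$, $$\alpha(n;k_1,\ldots,k_n)=(-1)^{n-1}\,\alpha(n;k_2,\ldots,k_n,k_1-n).$$ Moreover, for every $n\ge 1$ the function $k\mapsto\alpha(n;1,2,\ldots,n-1,k)$ is even if $n$ is odd and odd if $n$ is even, that is, for all $k\in\mathbb{Z}$, $$\alpha(n;1,2,\ldots,n-1,-k)=(-1)^{n-1}\,\alpha(n;1,2,\ldots,n-1,k).$$ -/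

import Mathlib

namespace MonotoneTriangle

open MvPolynomial

/-- The shift operator `E_{k_p}` on polynomials in `k_1, …, k_n` over `ℚ`: it replaces the variable
`k_p` by `k_p + 1` and fixes the other variables. (Indices are `0`-based: `Fin n`.) -/
noncomputable def shiftOp {n : ℕ} (p : Fin n) : Module.End ℚ (MvPolynomial (Fin n) ℚ) :=
  (aeval fun i : Fin n => if i = p then X i + 1 else X i :
    MvPolynomial (Fin n) ℚ →ₐ[ℚ] MvPolynomial (Fin n) ℚ).toLinearMap

/-- The difference operator `Δ_{k_p} = E_{k_p} - id`. -/
noncomputable def diffOp {n : ℕ} (p : Fin n) : Module.End ℚ (MvPolynomial (Fin n) ℚ) :=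
  shiftOp p - 1

/-- The operator `id + E_{k_p} Δ_{k_q}`; the product in `Module.End` is composition. -/
noncomputable def factorOp {n : ℕ} (pq : Fin n × Fin n) :
    Module.End ℚ (MvPolynomial (Fin n) ℚ) :=
  1 + shiftOp pq.1 * diffOp pq.2

/-- Shift operators commute. -/
theorem shiftOp_commute {n : ℕ} (p q : Fin n) : Commute (shiftOp p) (shiftOp q) := by
  have h : ((aeval fun i : Fin n => if i = p then X i + 1 else X i :
        MvPolynomial (Fin n) ℚ →ₐ[ℚ] MvPolynomial (Fin n) ℚ).comp
      (aeval fun i : Fin n => if i = q then X i + 1 else X i)) =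
      ((aeval fun i : Fin n => if i = q then X i + 1 else X i :
        MvPolynomial (Fin n) ℚ →ₐ[ℚ] MvPolynomial (Fin n) ℚ).comp
      (aeval fun i : Fin n => if i = p then X i + 1 else X i)) := by
    apply MvPolynomial.algHom_ext
    intro i
    by_cases hp : i = p <;> by_cases hq : i = q <;> simp [hp, hq] <;> split_ifs <;> simp_all
  refine LinearMap.ext fun f => ?_
  exact DFunLike.congr_fun h f

/-- The operators `id + E_{k_p} Δ_{k_q}` commute, so that their product needs no ordering. -/
theorem factorOp_commute {n : ℕ} (x y : Fin n × Fin n) : Commute (factorOp x) (factorOp y) := by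
  have hd : ∀ p q : Fin n, Commute (shiftOp p) (diffOp q) := fun p q =>
    (shiftOp_commute p q).sub_right (Commute.one_right _)
  have hdd : ∀ p q : Fin n, Commute (diffOp p) (diffOp q) := fun p q =>
    (hd p q).sub_left (Commute.one_left _)
  have h : Commute (shiftOp x.1 * diffOp x.2) (shiftOp y.1 * diffOp y.2) :=
    ((shiftOp_commute _ _).mul_right (hd _ _)).mul_left ((hd _ _).symm.mul_right (hdd _ _))
  exact ((Commute.one_right _).add_right ((Commute.one_left _).add_left h))

/-- The pairs of indices `(p, q)` with `p < q`. -/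
def orderedPairs (n : ℕ) : Finset (Fin n × Fin n) :=
  Finset.univ.filter fun x => x.1 < x.2

/-- The polynomial `∏_{i < j} (k_j - k_i) / (j - i)`. -/
noncomputable def vandermondeQuot (n : ℕ) : MvPolynomial (Fin n) ℚ :=
  ∏ x ∈ orderedPairs n, C (((x.2 : ℕ) : ℚ) - ((x.1 : ℕ) : ℚ))⁻¹ * (X x.2 - X x.1)

/-- The polynomial
`(∏_{p < q} (id + E_{k_p} Δ_{k_q})) ∏_{i < j} (k_j - k_i) / (j - i)`. -/
noncomputable def alphaPoly (n : ℕ) : MvPolynomial (Fin n) ℚ :=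
  (orderedPairs n).noncommProd factorOp (fun x _ y _ _ => factorOp_commute x y)
    (vandermondeQuot n)

/-- `α(n; k_1, …, k_n)` for an arbitrary integer vector `(k_1, …, k_n)`. -/
noncomputable def alpha (n : ℕ) (k : Fin n → ℤ) : ℚ :=
  eval (fun i => (k i : ℚ)) (alphaPoly n)

end MonotoneTriangle

namespace MonotoneTriangle

open MvPolynomial

/-! Write `V` for the Vandermonde quotient and work in the commutative algebra generated by the
shifts. Replacing each `x^j` by another monic polynomial of degree `j` preserves the Vandermonde
determinant, so `∏ (id + b Δ_p)` fixes `V` for scalar `b`, hence also with any operator `s` in place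
of `b`. Taking `s = E_0`, and also using the reciprocal form of the identity, gives `∏ (id + E_0
Δ_p) V = V` and `∏ (id + E_p Δ_0) V = E_0^n V`. Both products contain the injective factor `id + E_0
Δ_0`; cancelling it (`prod_factor_succ_zero_smul_vandermondeQuot`) gives the exchange of factors
that rotating the variables requires.

The parity statement follows from rotation, invariance under translation, and the symmetry `k_i ↦
-k_{n+1-i}` (`reflect_alphaPoly`). -/

/-! ### Products over ordered pairs. -/

theorem prod_orderedPairs_eq_prod_Ioi {M : Type*} [CommMonoid M] {n : ℕ} (f : Fin n × Fin n → M) :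
    ∏ x ∈ orderedPairs n, f x = ∏ i, ∏ j ∈ Finset.Ioi i, f (i, j) := by
  rw [orderedPairs, Finset.prod_filter, ← Finset.univ_product_univ, Finset.prod_product]
  refine Finset.prod_congr rfl fun i _ => ?_
  rw [← Finset.prod_filter]
  refine Finset.prod_congr ?_ fun _ _ => rfl
  ext j
  simp

theorem prod_orderedPairs_eq_prod_Iio {M : Type*} [CommMonoid M] {n : ℕ} (f : Fin n × Fin n → M) :
    ∏ x ∈ orderedPairs n, f x = ∏ j, ∏ i ∈ Finset.Iio j, f (i, j) := by
  rw [orderedPairs, Finset.prod_filter, ← Finset.univ_product_univ, Finset.prod_product_right]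
  refine Finset.prod_congr rfl fun i _ => ?_
  rw [← Finset.prod_filter]
  refine Finset.prod_congr ?_ fun _ _ => rfl
  ext j
  simp

theorem prod_orderedPairs_succ {M : Type*} [CommMonoid M] {m : ℕ}
    (f : Fin (m + 1) × Fin (m + 1) → M) :
    ∏ x ∈ orderedPairs (m + 1), f x =
      (∏ j : Fin m, f (0, j.succ)) * ∏ x ∈ orderedPairs m, f (x.1.succ, x.2.succ) := by
  rw [prod_orderedPairs_eq_prod_Ioi, Fin.prod_univ_succ, Fin.prod_Ioi_zero,
    prod_orderedPairs_eq_prod_Ioi]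
  simp only [Fin.prod_Ioi_succ]

theorem prod_orderedPairs_castSucc {M : Type*} [CommMonoid M] {m : ℕ}
    (f : Fin (m + 1) × Fin (m + 1) → M) :
    ∏ x ∈ orderedPairs (m + 1), f x =
      (∏ i : Fin m, f (i.castSucc, Fin.last m)) *
        ∏ x ∈ orderedPairs m, f (x.1.castSucc, x.2.castSucc) := by
  rw [prod_orderedPairs_eq_prod_Iio, Fin.prod_univ_castSucc, Fin.Iio_last_eq_map,
    Finset.prod_map, prod_orderedPairs_eq_prod_Iio, mul_comm]
  simp only [Fin.prod_Iio_castSucc, Fin.coe_castSuccEmb]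

theorem prod_orderedPairs_rev {M : Type*} [CommMonoid M] {n : ℕ} (f : Fin n × Fin n → M) :
    ∏ x ∈ orderedPairs n, f (x.2.rev, x.1.rev) = ∏ x ∈ orderedPairs n, f x :=
  Finset.prod_nbij' (fun x => (x.2.rev, x.1.rev)) (fun x => (x.2.rev, x.1.rev))
    (by simp [orderedPairs]) (by simp [orderedPairs]) (by simp) (by simp) (by simp)

/-- Each index lies in `n - 1` pairs; the extra factor avoids the exponent `n - 1`. -/
theorem prod_orderedPairs_mul_mul_prod {M : Type*} [CommMonoid M] :
    ∀ {n : ℕ} (g : Fin n → M),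
      (∏ x ∈ orderedPairs n, g x.1 * g x.2) * ∏ i, g i = (∏ i, g i) ^ n
  | 0, g => by simp [orderedPairs]
  | n + 1, g => by
    have ih := prod_orderedPairs_mul_mul_prod fun i => g i.succ
    rw [prod_orderedPairs_succ, Finset.prod_mul_distrib, Fin.prod_univ_succ, mul_pow,
      pow_succ (∏ i : Fin n, g i.succ), ← ih, pow_succ]
    simp only [Finset.prod_const, Finset.card_univ, Fintype.card_fin]
    ac_rfl

/-! ### The commutative algebra of shifts. -/

/-- A polynomial with operator coefficients annihilates a vector at every operator as soon as it
does so at every nonzero scalar. -/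
theorem polynomial_eval_smul_eq_zero {S M : Type*} [CommRing S] [Algebra ℚ S] [AddCommGroup M]
    [Module ℚ M] [Module S M] [IsScalarTower ℚ S M] (Q : Polynomial S) (v : M)
    (h : ∀ c : ℚ, c ≠ 0 → Q.eval (algebraMap ℚ S c) • v = 0) (s : S) : Q.eval s • v = 0 := by
  have hcoeff : ∀ j ∈ Finset.range (Q.natDegree + 1), Q.coeff j • v = 0 := by
    intro j hj
    -- Each functional turns the hypothesis into a rational polynomial with infinitely many roots,
    -- so every coefficient of `Q` kills `v`.
    rw [← Module.forall_dual_apply_eq_zero_iff ℚ]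
    intro φ
    let p : Polynomial ℚ := ∑ i ∈ Finset.range (Q.natDegree + 1),
      Polynomial.C (φ (Q.coeff i • v)) * Polynomial.X ^ i
    have hp : p = 0 := by
      refine Polynomial.eq_zero_of_infinite_isRoot p (Set.Infinite.mono (s := {0}ᶜ) ?_
        (Set.finite_singleton (0 : ℚ)).infinite_compl)
      intro c hc
      have hc' := congrArg φ (h c hc)
      rw [Polynomial.eval_eq_sum_range, Finset.sum_smul, map_sum, map_zero] at hc'
      rw [Set.mem_ofPred_eq, Polynomial.IsRoot.def, Polynomial.eval_finsetSum, ← hc']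
      refine Finset.sum_congr rfl fun i _ => ?_
      rw [← map_pow, mul_comm (Q.coeff i), ← Algebra.smul_def, smul_assoc, LinearMap.map_smul,
        Polynomial.eval_mul, Polynomial.eval_C, Polynomial.eval_pow, Polynomial.eval_X, smul_eq_mul,
        mul_comm]
    have hcf : p.coeff j = φ (Q.coeff j • v) := by
      simp only [p, Polynomial.finsetSum_coeff, Polynomial.coeff_C_mul_X_pow]
      rw [Finset.sum_ite_eq, if_pos hj]
    rw [← hcf, hp, Polynomial.coeff_zero]
  rw [Polynomial.eval_eq_sum_range, Finset.sum_smul]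
  refine Finset.sum_eq_zero fun j hj => ?_
  rw [mul_comm, mul_smul, hcoeff j hj, smul_zero]

/-- The subalgebra of operators generated by the shifts. -/
noncomputable def shiftSubalgebra (n : ℕ) :
    Subalgebra ℚ (Module.End ℚ (MvPolynomial (Fin n) ℚ)) :=
  Algebra.adjoin ℚ (Set.range shiftOp)

instance (n : ℕ) : IsMulCommutative (shiftSubalgebra n) :=
  Algebra.isMulCommutative_adjoin ℚ (by
    rintro _ ⟨p, rfl⟩ _ ⟨q, rfl⟩
    exact shiftOp_commute p q)

/-- The operators generated by the shifts, as a commutative ring acting on polynomials. -/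
def ShiftAlgebra (n : ℕ) : Type := shiftSubalgebra n

open scoped IsMulCommutative in
noncomputable instance (n : ℕ) : CommRing (ShiftAlgebra n) :=
  inferInstanceAs (CommRing (shiftSubalgebra n))

noncomputable instance (n : ℕ) : Algebra ℚ (ShiftAlgebra n) :=
  inferInstanceAs (Algebra ℚ (shiftSubalgebra n))

noncomputable instance (n : ℕ) : Module (ShiftAlgebra n) (MvPolynomial (Fin n) ℚ) :=
  inferInstanceAs (Module (shiftSubalgebra n) (MvPolynomial (Fin n) ℚ))

instance (n : ℕ) : IsScalarTower ℚ (ShiftAlgebra n) (MvPolynomial (Fin n) ℚ) :=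
  ⟨fun _ _ _ => rfl⟩

/-- The inclusion of `ShiftAlgebra n` into the algebra of all operators. -/
noncomputable def ShiftAlgebra.toEnd (n : ℕ) :
    ShiftAlgebra n →+* Module.End ℚ (MvPolynomial (Fin n) ℚ) :=
  Module.toModuleEnd ℚ (S := ShiftAlgebra n) (MvPolynomial (Fin n) ℚ)

/-- The shift operator as an element of `ShiftAlgebra n`. -/
noncomputable def shift {n : ℕ} (p : Fin n) : ShiftAlgebra n :=
  (⟨shiftOp p, Algebra.subset_adjoin ⟨p, rfl⟩⟩ : shiftSubalgebra n)

/-- The operator `id + E_{k_p} Δ_{k_q}` as an element of `ShiftAlgebra n`. -/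
noncomputable def factor {n : ℕ} (x : Fin n × Fin n) : ShiftAlgebra n :=
  1 + shift x.1 * (shift x.2 - 1)

theorem toEnd_shift {n : ℕ} (p : Fin n) : ShiftAlgebra.toEnd n (shift p) = shiftOp p := rfl

theorem toEnd_factor {n : ℕ} (x : Fin n × Fin n) :
    ShiftAlgebra.toEnd n (factor x) = factorOp x := by
  simp only [factor, map_add, map_mul, map_sub, map_one, toEnd_shift, factorOp, diffOp]

theorem alphaPoly_eq (n : ℕ) :
    alphaPoly n = (∏ x ∈ orderedPairs n, factor x) • vandermondeQuot n := by
  have h : ShiftAlgebra.toEnd n (∏ x ∈ orderedPairs n, factor x) =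
      (orderedPairs n).noncommProd factorOp (fun x _ y _ _ => factorOp_commute x y) := by
    rw [← Finset.noncommProd_eq_prod]
    exact (Finset.map_noncommProd _ _ (fun _ _ _ _ _ => Commute.all _ _) _).trans
      (Finset.noncommProd_congr rfl (fun x _ => toEnd_factor x) _)
  rw [alphaPoly, ← h]
  rfl

theorem shift_smul {n : ℕ} (p : Fin n) (f : MvPolynomial (Fin n) ℚ) :
    shift p • f = aeval (fun i => if i = p then X i + 1 else X i) f := rfl

theorem shift_smul_mul {n : ℕ} (p : Fin n) (f g : MvPolynomial (Fin n) ℚ) :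
    shift p • (f * g) = (shift p • f) * (shift p • g) := by
  simp only [shift_smul, map_mul]

theorem eval_shift_smul {n : ℕ} (p : Fin n) (f : MvPolynomial (Fin n) ℚ) (k : Fin n → ℚ) :
    eval k (shift p • f) = eval (fun i => if i = p then k i + 1 else k i) f := by
  have h : (aeval k).comp (aeval (fun i => if i = p then X i + 1 else X i)) =
      (aeval (fun i => if i = p then k i + 1 else k i) : MvPolynomial (Fin n) ℚ →ₐ[ℚ] ℚ) := by
    ext i
    by_cases hi : i = p <;> simp [hi]
  simpa [shift_smul, aeval_eq_eval] using DFunLike.congr_fun h f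

theorem eval_shift_pow_smul {n : ℕ} (p : Fin n) (m : ℕ) (f : MvPolynomial (Fin n) ℚ)
    (k : Fin n → ℚ) :
    eval k (shift p ^ m • f) = eval (fun i => if i = p then k i + m else k i) f := by
  induction m generalizing k with
  | zero => simp
  | succ m ih =>
    rw [pow_succ', mul_smul, eval_shift_smul, ih]
    congr 2
    ext i
    by_cases hi : i = p <;> simp [hi]
    ring

/-- A polynomial killed by `id + E_{k_p} Δ_{k_p}` satisfies `E_{k_p}^3 f = -f`, so it vanishes. -/
theorem factor_self_smul_injective {n : ℕ} (p : Fin n) {f : MvPolynomial (Fin n) ℚ}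
    (hf : factor (p, p) • f = 0) : f = 0 := by
  have h3 : shift p ^ 3 • f = -f := by
    have h : shift p ^ 3 = (shift p + 1) * factor (p, p) - 1 := by
      simp only [factor]; ring
    rw [h, sub_smul, mul_smul, hf, smul_zero, one_smul, zero_sub]
  have h6 : shift p ^ 6 • f = f := by
    rw [show 6 = 3 + 3 from rfl, pow_add, mul_smul, h3, smul_neg, h3, neg_neg]
  have hm : ∀ m : ℕ, shift p ^ (6 * m) • f = f := by
    intro m
    rw [pow_mul]
    induction m with
    | zero => simp
    | succ m ih => rw [pow_succ, mul_smul, h6, ih]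
  refine funext fun k => ?_
  let g : Polynomial ℚ :=
    aeval (fun i => if i = p then Polynomial.C (k i) + Polynomial.X else Polynomial.C (k i)) f
  have hg : ∀ t : ℚ, g.eval t = eval (fun i => if i = p then k i + t else k i) f := by
    intro t
    have h : ((Polynomial.aeval t).comp (aeval fun i =>
        if i = p then Polynomial.C (k i) + Polynomial.X else Polynomial.C (k i))) =
        (aeval (fun i => if i = p then k i + t else k i) : MvPolynomial (Fin n) ℚ →ₐ[ℚ] ℚ) := by
      ext i
      by_cases hi : i = p <;> simp [hi]
    have := DFunLike.congr_fun h f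
    simpa [aeval_eq_eval, g, Polynomial.coe_aeval_eq_eval] using this
  -- On a line in direction `p`, `f` takes one value at all multiples of 6, so it is constant there;
  -- `E_p^3 f = -f` then makes it zero.
  have hconst : g = Polynomial.C (eval k f) := by
    refine Polynomial.eq_of_infinite_eval_eq _ _
      (Set.Infinite.mono (s := Set.range fun m : ℕ => (6 * m : ℚ)) ?_
        (Set.infinite_range_of_injective fun a b hab => by simpa using hab))
    rintro _ ⟨m, rfl⟩
    have h := congrArg (eval k) (hm m)
    rw [eval_shift_pow_smul] at h
    rw [Set.mem_ofPred_eq, hg, Polynomial.eval_C, ← h]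
    push_cast
    rfl
  have h := congrArg (eval k) h3
  rw [eval_shift_pow_smul, ← hg, hconst, Polynomial.eval_C, map_neg] at h
  rw [map_zero]
  linarith

/-! ### Difference operators acting on the Vandermonde product. -/

theorem smul_C_mul {n : ℕ} (A : ShiftAlgebra n) (c : ℚ) (f : MvPolynomial (Fin n) ℚ) :
    A • (C c * f) = C c * (A • f) := by
  rw [C_mul', C_mul']
  exact (ShiftAlgebra.toEnd n A).map_smul c f

theorem shift_smul_aeval_X_self {n : ℕ} (p : Fin n) (g : Polynomial ℚ) :
    shift p • Polynomial.aeval (X p : MvPolynomial (Fin n) ℚ) g =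
      Polynomial.aeval (X p) (g.comp (Polynomial.X + 1)) := by
  rw [shift_smul, ← Polynomial.aeval_algHom_apply, Polynomial.aeval_comp]
  simp

theorem shift_smul_aeval_X_of_ne {n : ℕ} {p i : Fin n} (h : i ≠ p) (g : Polynomial ℚ) :
    shift p • Polynomial.aeval (X i : MvPolynomial (Fin n) ℚ) g = Polynomial.aeval (X i) g := by
  rw [shift_smul, ← Polynomial.aeval_algHom_apply]
  simp [h]

/-- The operator `id + b Δ` on polynomials in one variable. -/
noncomputable def addDiff (b : ℚ) (g : Polynomial ℚ) : Polynomial ℚ :=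
  g + Polynomial.C b * (g.comp (Polynomial.X + 1) - g)

theorem one_add_diff_smul_prod {n : ℕ} (b : ℚ) (p : Fin n) (g : Fin n → Polynomial ℚ) :
    (1 + algebraMap ℚ (ShiftAlgebra n) b * (shift p - 1)) •
        ∏ i, Polynomial.aeval (X i : MvPolynomial (Fin n) ℚ) (g i) =
      ∏ i, Polynomial.aeval (X i) (Function.update g p (addDiff b (g p)) i) := by
  have hfix : shift p • ∏ i ∈ Finset.univ.erase p,
      Polynomial.aeval (X i : MvPolynomial (Fin n) ℚ) (g i) =
        ∏ i ∈ Finset.univ.erase p, Polynomial.aeval (X i) (g i) := by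
    rw [shift_smul, map_prod]
    exact Finset.prod_congr rfl fun i hi =>
      shift_smul_aeval_X_of_ne (Finset.ne_of_mem_erase hi) (g i)
  rw [← Finset.mul_prod_erase _ _ (Finset.mem_univ p), ← Finset.mul_prod_erase _ _
    (Finset.mem_univ p), add_smul, mul_smul, sub_smul, one_smul, shift_smul_mul, hfix,
    algebraMap_smul, shift_smul_aeval_X_self, Function.update_self]
  have hcongr : ∏ i ∈ Finset.univ.erase p, Polynomial.aeval (X i : MvPolynomial (Fin n) ℚ)
      (Function.update g p (addDiff b (g p)) i) =
        ∏ i ∈ Finset.univ.erase p, Polynomial.aeval (X i) (g i) :=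
    Finset.prod_congr rfl fun i hi => by
      rw [Function.update_of_ne (Finset.ne_of_mem_erase hi)]
  rw [hcongr, addDiff, map_add, map_mul, map_sub, Polynomial.aeval_C, algebraMap_eq, smul_eq_C_mul]
  ring

theorem prod_one_add_diff_smul_prod {n : ℕ} (b : ℚ) (g : Fin n → Polynomial ℚ) :
    (∏ p, (1 + algebraMap ℚ (ShiftAlgebra n) b * (shift p - 1))) •
        ∏ i, Polynomial.aeval (X i : MvPolynomial (Fin n) ℚ) (g i) =
      ∏ i, Polynomial.aeval (X i) (addDiff b (g i)) := by
  have h : ∀ s : Finset (Fin n),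
      (∏ p ∈ s, (1 + algebraMap ℚ (ShiftAlgebra n) b * (shift p - 1))) •
        ∏ i, Polynomial.aeval (X i : MvPolynomial (Fin n) ℚ) (g i) =
      ∏ i, Polynomial.aeval (X i) (if i ∈ s then addDiff b (g i) else g i) := by
    intro s
    induction s using Finset.induction_on with
    | empty => simp
    | insert a s ha ih =>
      rw [Finset.prod_insert ha, mul_smul, ih, one_add_diff_smul_prod]
      refine Finset.prod_congr rfl fun i _ => ?_
      by_cases hi : i = a
      · subst hi; simp [ha]
      · simp [hi]
  simpa using h Finset.univ

theorem natDegree_addDiff_X_pow_and_monic (b : ℚ) (j : ℕ) :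
    (addDiff b (Polynomial.X ^ j)).natDegree = j ∧ (addDiff b (Polynomial.X ^ j)).Monic := by
  have hm : ((Polynomial.X + 1 : Polynomial ℚ) ^ j).Monic :=
    (Polynomial.monic_X_add_C (1 : ℚ)).pow j
  have hd : ((Polynomial.X + 1 : Polynomial ℚ) ^ j).degree = j := by
    rw [Polynomial.degree_pow, ← Polynomial.C_1, Polynomial.degree_X_add_C]
    simp
  have hlt : (Polynomial.C b * ((Polynomial.X + 1) ^ j - Polynomial.X ^ j)).degree <
      (Polynomial.X ^ j : Polynomial ℚ).degree := by
    rw [← Polynomial.smul_eq_C_mul]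
    refine lt_of_le_of_lt (Polynomial.degree_smul_le _ _) ?_
    rw [Polynomial.degree_X_pow, ← hd]
    exact Polynomial.degree_sub_lt_left (by rw [hd, Polynomial.degree_X_pow]) hm.ne_zero
      (by rw [hm.leadingCoeff, (Polynomial.monic_X_pow j).leadingCoeff])
  rw [addDiff, Polynomial.X_pow_comp]
  exact ⟨by rw [Polynomial.natDegree_add_eq_left_of_degree_lt hlt, Polynomial.natDegree_X_pow],
    (Polynomial.monic_X_pow j).add_of_left hlt⟩

theorem smul_det_aeval_X {n : ℕ} (A : ShiftAlgebra n) (g : Fin n → Polynomial ℚ) :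
    A • (Matrix.of fun i j => Polynomial.aeval (X i : MvPolynomial (Fin n) ℚ) (g j)).det =
      ∑ σ : Equiv.Perm (Fin n), (Equiv.Perm.sign σ : ℤ) •
        (A • ∏ i, Polynomial.aeval (X i : MvPolynomial (Fin n) ℚ) (g (σ i))) := by
  rw [← Matrix.det_transpose, Matrix.det_apply, Finset.smul_sum]
  refine Finset.sum_congr rfl fun σ _ => ?_
  rw [Units.smul_def]
  exact map_zsmul (ShiftAlgebra.toEnd n A) _ _

/-- In the expanded determinant the operators act on each variable separately, turning `x^j` into
`addDiff b (x^j)`. This is monic of degree `j`, so the determinant does not change. -/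
theorem prod_one_add_diff_smul_vandermonde {n : ℕ} (b : ℚ) :
    (∏ p, (1 + algebraMap ℚ (ShiftAlgebra n) b * (shift p - 1))) •
        (Matrix.vandermonde (X : Fin n → MvPolynomial (Fin n) ℚ)).det =
      (Matrix.vandermonde (X : Fin n → MvPolynomial (Fin n) ℚ)).det := by
  have h0 : Matrix.vandermonde (X : Fin n → MvPolynomial (Fin n) ℚ) =
      Matrix.of fun i j : Fin n => Polynomial.aeval (X i : MvPolynomial (Fin n) ℚ)
        (Polynomial.X ^ (j : ℕ) : Polynomial ℚ) := by
    apply Matrix.ext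
    intro i j
    simp [Matrix.vandermonde_apply]
  have h1 : (Matrix.vandermonde (X : Fin n → MvPolynomial (Fin n) ℚ)).det =
      (Matrix.of fun i j : Fin n => Polynomial.aeval (X i : MvPolynomial (Fin n) ℚ)
        (addDiff b (Polynomial.X ^ (j : ℕ)))).det := by
    rw [Matrix.det_eval_matrixOfPolynomials_eq_det_vandermonde X
      (fun j : Fin n => (addDiff b (Polynomial.X ^ (j : ℕ))).map C)
      (fun j => by
        rw [(natDegree_addDiff_X_pow_and_monic b j).2.natDegree_map]
        exact (natDegree_addDiff_X_pow_and_monic b j).1)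
      (fun j => (natDegree_addDiff_X_pow_and_monic b j).2.map C)]
    congr 1
    apply Matrix.ext
    intro i j
    simp [Polynomial.eval_map, Polynomial.aeval_def, algebraMap_eq]
  have h2 := smul_det_aeval_X (1 : ShiftAlgebra n)
    (fun j : Fin n => addDiff b (Polynomial.X ^ (j : ℕ)))
  simp only [one_smul] at h2
  refine Eq.trans ?_ (h1.trans h2).symm
  rw [h0, smul_det_aeval_X]
  simp only [prod_one_add_diff_smul_prod]

theorem vandermondeQuot_eq (n : ℕ) :
    vandermondeQuot n = C (∏ x ∈ orderedPairs n, (((x.2 : ℕ) : ℚ) - ((x.1 : ℕ) : ℚ))⁻¹) *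
      ∏ x ∈ orderedPairs n, (X x.2 - X x.1) := by
  rw [vandermondeQuot, Finset.prod_mul_distrib, map_prod]

theorem prod_sub_eq_det_vandermonde (n : ℕ) :
    ∏ x ∈ orderedPairs n, (X x.2 - X x.1 : MvPolynomial (Fin n) ℚ) =
      (Matrix.vandermonde (X : Fin n → MvPolynomial (Fin n) ℚ)).det := by
  rw [Matrix.det_vandermonde, prod_orderedPairs_eq_prod_Ioi]

/-- Every `∏_q (id + s Δ_{k_q})` with `s` generated by the shifts fixes the Vandermonde product:
the elementary symmetric functions of the `Δ_{k_q}` of positive degree annihilate it. -/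
theorem prod_one_add_mul_diff_smul_vandermondeQuot {n : ℕ} (s : ShiftAlgebra n) :
    (∏ p, (1 + s * (shift p - 1))) • vandermondeQuot n = vandermondeQuot n := by
  have h := polynomial_eval_smul_eq_zero
    ((∏ p, (1 + Polynomial.X * Polynomial.C (shift p - 1))) - 1 : Polynomial (ShiftAlgebra n))
    (vandermondeQuot n) (fun c _ => by
      simp only [Polynomial.eval_sub, Polynomial.eval_prod, Polynomial.eval_add,
        Polynomial.eval_mul, Polynomial.eval_one, Polynomial.eval_X, Polynomial.eval_C]
      rw [sub_smul, one_smul, sub_eq_zero, vandermondeQuot_eq, smul_C_mul,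
        prod_sub_eq_det_vandermonde, prod_one_add_diff_smul_vandermonde]) s
  simp only [Polynomial.eval_sub, Polynomial.eval_prod, Polynomial.eval_add,
    Polynomial.eval_mul, Polynomial.eval_one, Polynomial.eval_X, Polynomial.eval_C] at h
  rwa [sub_smul, one_smul, sub_eq_zero] at h

/-- For a nonzero scalar `c`, `1 + E_p (c - 1) = c (1 + (1 - c⁻¹) Δ_p)`, which reduces to the
previous identity. Passing to operators removes the need to invert `s`. -/
theorem prod_one_add_shift_mul_smul_vandermondeQuot {n : ℕ} (s : ShiftAlgebra n) :
    (∏ p, (1 + shift p * (s - 1))) • vandermondeQuot n = s ^ n • vandermondeQuot n := by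
  have h := polynomial_eval_smul_eq_zero
    ((∏ p, (1 + Polynomial.C (shift p) * (Polynomial.X - 1))) - Polynomial.X ^ n :
      Polynomial (ShiftAlgebra n))
    (vandermondeQuot n) (fun c hc => by
      simp only [Polynomial.eval_sub, Polynomial.eval_prod, Polynomial.eval_add,
        Polynomial.eval_mul, Polynomial.eval_one, Polynomial.eval_X, Polynomial.eval_C,
        Polynomial.eval_pow]
      have hc' : algebraMap ℚ (ShiftAlgebra n) c * algebraMap ℚ (ShiftAlgebra n) c⁻¹ = 1 := by
        rw [← map_mul, mul_inv_cancel₀ hc, map_one]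
      have hfac : ∏ p : Fin n, (1 + shift p * (algebraMap ℚ (ShiftAlgebra n) c - 1)) =
          algebraMap ℚ (ShiftAlgebra n) c ^ n *
            ∏ p, (1 + (1 - algebraMap ℚ (ShiftAlgebra n) c⁻¹) * (shift p - 1)) := by
        rw [← Fin.prod_const, ← Finset.prod_mul_distrib]
        refine Finset.prod_congr rfl fun p _ => ?_
        linear_combination (shift p - 1) * hc'
      rw [hfac, sub_smul, mul_smul, prod_one_add_mul_diff_smul_vandermondeQuot, sub_self]) s
  simp only [Polynomial.eval_sub, Polynomial.eval_prod, Polynomial.eval_add,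
    Polynomial.eval_mul, Polynomial.eval_one, Polynomial.eval_X, Polynomial.eval_C,
    Polynomial.eval_pow] at h
  rwa [sub_smul, sub_eq_zero] at h

/-! ### Rotation of the variables. -/

theorem prod_factor_succ_zero_smul_vandermondeQuot (m : ℕ) :
    (∏ j : Fin m, factor (j.succ, 0)) • vandermondeQuot (m + 1) =
      (shift 0 ^ (m + 1) * ∏ j : Fin m, factor (0, j.succ)) • vandermondeQuot (m + 1) := by
  rw [← sub_eq_zero]
  apply factor_self_smul_injective 0
  have h1 := prod_one_add_shift_mul_smul_vandermondeQuot (shift (0 : Fin (m + 1)))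
  have h2 := prod_one_add_mul_diff_smul_vandermondeQuot (shift (0 : Fin (m + 1)))
  rw [Fin.prod_univ_succ] at h1 h2
  rw [smul_sub, ← mul_smul, ← mul_smul, mul_left_comm, mul_smul (shift 0 ^ (m + 1)), sub_eq_zero]
  exact h1.trans (congrArg _ h2.symm)

/-- The factors `c` clear the inverse shifts that moving operators past `L` may create: rotation
needs none, reflection does. -/
theorem prod_smul_map_prod_smul {ι : Type*} {n : ℕ}
    (L : MvPolynomial (Fin n) ℚ →ₐ[ℚ] MvPolynomial (Fin n) ℚ) (s : Finset ι)
    (a b c : ι → ShiftAlgebra n) (h : ∀ x f, c x • L (a x • f) = b x • L f)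
    (f : MvPolynomial (Fin n) ℚ) :
    (∏ x ∈ s, c x) • L ((∏ x ∈ s, a x) • f) = (∏ x ∈ s, b x) • L f := by
  classical
  induction s using Finset.induction_on with
  | empty => simp
  | insert x s hx ih =>
    rw [Finset.prod_insert hx, Finset.prod_insert hx, Finset.prod_insert hx, mul_comm (c x),
      mul_smul, mul_smul (a x), h, mul_smul (b x), ← ih, smul_comm]

theorem rename_shift_smul {n : ℕ} (σ : Equiv.Perm (Fin n)) (p : Fin n)
    (f : MvPolynomial (Fin n) ℚ) : rename σ (shift p • f) = shift (σ p) • rename σ f := by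
  have h : (rename σ).comp (aeval fun i => if i = p then X i + 1 else X i) =
      (aeval fun i => if i = σ p then X i + 1 else X i : MvPolynomial (Fin n) ℚ →ₐ[ℚ] _).comp
        (rename σ) := by
    refine algHom_ext fun i => ?_
    by_cases hi : i = p <;> simp [hi]
  exact DFunLike.congr_fun h f

theorem rename_factor_smul {n : ℕ} (σ : Equiv.Perm (Fin n)) (x : Fin n × Fin n)
    (f : MvPolynomial (Fin n) ℚ) :
    rename σ (factor x • f) = factor (σ x.1, σ x.2) • rename σ f := by
  simp only [factor, add_smul, mul_smul, sub_smul, one_smul, map_add, map_sub, rename_shift_smul]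

theorem rename_vandermondeQuot {n : ℕ} (σ : Equiv.Perm (Fin n)) :
    rename σ (vandermondeQuot n) = C ((Equiv.Perm.sign σ : ℤ) : ℚ) * vandermondeQuot n := by
  have h := σ.prod_Ioi_comp_eq_sign_mul_prod
    (f := fun i j => (X j - X i : MvPolynomial (Fin n) ℚ)) (fun i j => (neg_sub _ _).symm)
  rw [vandermondeQuot_eq, prod_orderedPairs_eq_prod_Ioi (fun x => X x.2 - X x.1), map_mul, rename_C]
  simp only [map_prod, map_sub, rename_X]
  rw [h, map_intCast]
  ring

theorem shift_zero_pow_smul_alphaPoly (m : ℕ) :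
    shift (0 : Fin (m + 1)) ^ (m + 1) • alphaPoly (m + 1) =
      C ((-1) ^ m) * rename (finRotate (m + 1)) (alphaPoly (m + 1)) := by
  -- Rotation reverses the order exactly in the pairs containing the last index, which becomes `0`.
  have hprod : ∏ x ∈ orderedPairs (m + 1),
      factor (finRotate (m + 1) x.1, finRotate (m + 1) x.2) =
        (∏ j : Fin m, factor (j.succ, 0)) * ∏ x ∈ orderedPairs m, factor (x.1.succ, x.2.succ) := by
    rw [prod_orderedPairs_castSucc]
    simp only [finRotate_apply, Fin.coeSucc_eq_succ, Fin.last_add_one]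
  have hrot := prod_smul_map_prod_smul (rename (finRotate (m + 1))) (orderedPairs (m + 1)) factor
    (fun x => factor (finRotate (m + 1) x.1, finRotate (m + 1) x.2)) (fun _ => 1)
    (fun x f => by rw [one_smul, rename_factor_smul]) (vandermondeQuot (m + 1))
  rw [Finset.prod_const_one, one_smul, rename_vandermondeQuot, sign_finRotate, smul_C_mul,
    hprod] at hrot
  rw [alphaPoly_eq, hrot, prod_orderedPairs_succ, ← mul_smul, ← mul_assoc, mul_comm _ (∏ x ∈ _, _),
    mul_smul, ← prod_factor_succ_zero_smul_vandermondeQuot, ← mul_smul, mul_comm (∏ x ∈ _, _)]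
  rw [← mul_assoc, ← C_mul]
  simp [← mul_pow]

theorem alpha_rotate (m : ℕ) (k : Fin (m + 1) → ℤ) :
    alpha (m + 1) k = (-1) ^ m * alpha (m + 1)
      (fun i => if h : (i : ℕ) + 1 < m + 1 then k ⟨(i : ℕ) + 1, h⟩
        else k 0 - ((m + 1 : ℕ) : ℤ)) := by
  -- Lowering `k_0` by `n` compensates for the shift `E_0^n`.
  have h := congrArg (eval fun i => if i = 0 then (k i : ℚ) - (m + 1 : ℕ) else k i)
    (shift_zero_pow_smul_alphaPoly m)
  rw [eval_shift_pow_smul, map_mul, eval_C, eval_rename] at h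
  rw [alpha, alpha]
  convert h using 3
  · ext i
    by_cases hi : i = 0 <;> simp [hi]
  · congr 1
    ext i
    refine Fin.lastCases ?_ (fun j => ?_) i
    · simp
    · have : (⟨(j : ℕ) + 1, by omega⟩ : Fin (m + 1)) = j.succ := rfl
      simp [Fin.coeSucc_eq_succ, Fin.succ_ne_zero, this]

/-! ### Translation and reflection. -/

theorem eval_prod_shift_smul {n : ℕ} (f : MvPolynomial (Fin n) ℚ) (k : Fin n → ℚ) :
    eval k ((∏ p : Fin n, shift p) • f) = eval (fun i => k i + 1) f := by
  have h : ∀ (s : Finset (Fin n)) (k : Fin n → ℚ),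
      eval k ((∏ p ∈ s, shift p : ShiftAlgebra n) • f) =
        eval (fun i => if i ∈ s then k i + 1 else k i) f := by
    intro s
    induction s using Finset.induction_on with
    | empty => simp
    | insert a s ha ih =>
      intro k
      rw [Finset.prod_insert ha, mul_smul, eval_shift_smul, ih]
      congr 2
      ext i
      by_cases hi : i = a
      · subst hi; simp [ha]
      · simp [hi]
  simpa using h Finset.univ k

theorem eval_add_one_alphaPoly {n : ℕ} (k : Fin n → ℚ) :
    eval (fun i => k i + 1) (alphaPoly n) = eval k (alphaPoly n) := by
  have h : (∏ p : Fin n, shift p) • vandermondeQuot n = vandermondeQuot n := by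
    refine funext fun k => ?_
    rw [eval_prod_shift_smul]
    simp [vandermondeQuot, map_prod]
  rw [← eval_prod_shift_smul, alphaPoly_eq, ← mul_smul, mul_comm, mul_smul, h]

theorem alpha_add_natCast {n : ℕ} (k : Fin n → ℤ) (c : ℕ) :
    alpha n (fun i => k i + c) = alpha n k := by
  induction c with
  | zero => simp
  | succ c ih =>
    rw [← ih, alpha, alpha, ← eval_add_one_alphaPoly fun i => ((k i + c : ℤ) : ℚ)]
    congr 2
    ext i
    push_cast
    ring

/-- The reflection `k_i ↦ -k_{n+1-i}`. -/
noncomputable def reflect (n : ℕ) : MvPolynomial (Fin n) ℚ →ₐ[ℚ] MvPolynomial (Fin n) ℚ :=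
  aeval fun i => -X i.rev

theorem eval_reflect {n : ℕ} (f : MvPolynomial (Fin n) ℚ) (k : Fin n → ℚ) :
    eval k (reflect n f) = eval (fun i => -k i.rev) f := by
  have h : (aeval k).comp (reflect n) =
      (aeval fun i => -k i.rev : MvPolynomial (Fin n) ℚ →ₐ[ℚ] ℚ) := by
    ext i
    simp [reflect]
  simpa [aeval_eq_eval] using DFunLike.congr_fun h f

theorem shift_rev_smul_reflect_shift_smul {n : ℕ} (p : Fin n) (f : MvPolynomial (Fin n) ℚ) :
    shift p.rev • reflect n (shift p • f) = reflect n f := by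
  have h : ((aeval fun i => if i = p.rev then X i + 1 else X i :
        MvPolynomial (Fin n) ℚ →ₐ[ℚ] _).comp (reflect n)).comp
        (aeval fun i => if i = p then X i + 1 else X i) = reflect n := by
    refine algHom_ext fun i => ?_
    by_cases hi : i = p <;> simp [hi, reflect]
  exact DFunLike.congr_fun h f

/-- Reflection turns `E_p` into the inverse of `E_{p.rev}`. Clearing denominators in `1 + E_p E_q -
E_p` gives `E_{p.rev} E_{q.rev} + 1 - E_{q.rev}`. -/
theorem reflect_factor_smul {n : ℕ} (x : Fin n × Fin n) (f : MvPolynomial (Fin n) ℚ) :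
    (shift x.1.rev * shift x.2.rev) • reflect n (factor x • f) =
      factor (x.2.rev, x.1.rev) • reflect n f := by
  have h : factor x • f = f + shift x.1 • (shift x.2 • f) - shift x.1 • f := by
    simp only [factor, add_smul, mul_smul, sub_smul, one_smul, smul_sub, add_sub_assoc]
  have h1 : (shift x.1.rev * shift x.2.rev) • reflect n (shift x.1 • (shift x.2 • f)) =
      reflect n f := by
    rw [mul_comm, mul_smul, shift_rev_smul_reflect_shift_smul, shift_rev_smul_reflect_shift_smul]
  have h2 : (shift x.1.rev * shift x.2.rev) • reflect n (shift x.1 • f) =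
      shift x.2.rev • reflect n f := by
    rw [mul_comm, mul_smul, shift_rev_smul_reflect_shift_smul]
  rw [h, map_sub, map_add, smul_sub, smul_add, h1, h2]
  simp only [factor, add_smul, mul_sub, sub_smul, one_smul, mul_one, mul_comm (shift x.1.rev)]
  abel

theorem reflect_vandermondeQuot (n : ℕ) : reflect n (vandermondeQuot n) = vandermondeQuot n := by
  rw [vandermondeQuot_eq, map_mul, algHom_C, algebraMap_eq, map_prod (reflect n)]
  refine congrArg _ (Eq.trans (Finset.prod_congr rfl fun x _ => ?_)
    (prod_orderedPairs_rev (M := MvPolynomial (Fin n) ℚ) fun x => X x.2 - X x.1))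
  simp only [reflect, map_sub, aeval_X]
  ring

theorem reflect_alphaPoly (n : ℕ) : reflect n (alphaPoly n) = alphaPoly n := by
  have h := prod_smul_map_prod_smul (reflect n) (orderedPairs n) factor
    (fun x => factor (x.2.rev, x.1.rev)) (fun x => shift x.1.rev * shift x.2.rev)
    (fun x f => reflect_factor_smul x f) (vandermondeQuot n)
  rw [reflect_vandermondeQuot, prod_orderedPairs_rev (M := ShiftAlgebra n) factor,
    ← alphaPoly_eq] at h
  have hT : (∏ p : Fin n, shift p) • reflect n (alphaPoly n) = reflect n (alphaPoly n) := by
    refine funext fun k => ?_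
    rw [eval_prod_shift_smul, eval_reflect, eval_reflect, ← eval_add_one_alphaPoly]
    congr 2
    ext i
    ring
  have hTn : ∀ j : ℕ,
      (∏ p : Fin n, shift p) ^ j • reflect n (alphaPoly n) = reflect n (alphaPoly n) := by
    intro j
    induction j with
    | zero => simp
    | succ j ih => rw [pow_succ, mul_smul, hT, ih]
  have hrev : ∏ p : Fin n, shift p.rev = ∏ p : Fin n, shift p := Equiv.prod_comp Fin.revPerm shift
  have hpow := prod_orderedPairs_mul_mul_prod fun p : Fin n => shift p.rev
  rw [hrev] at hpow
  have hfix : (∏ x ∈ orderedPairs n, shift x.1.rev * shift x.2.rev) • reflect n (alphaPoly n) =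
      reflect n (alphaPoly n) := by
    -- A diagonal translation, which acts trivially here, supplies the factor needed to apply
    -- `hpow`.
    conv_lhs => rw [← hT]
    rw [← mul_smul, hpow, hTn]
  rwa [hfix] at h

theorem alpha_reflect {n : ℕ} (k : Fin n → ℤ) :
    alpha n k = alpha n fun i => -k i.rev := by
  rw [alpha, ← reflect_alphaPoly, eval_reflect, alpha]
  simp

end MonotoneTriangle

theorem lemma6 (n : ℕ) (hn : 1 ≤ n) :
    (∀ k : Fin n → ℤ,
      MonotoneTriangle.alpha n k =
        (-1) ^ (n - 1) *
          MonotoneTriangle.alpha n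
            (fun i => if h : (i : ℕ) + 1 < n then k ⟨(i : ℕ) + 1, h⟩
              else k ⟨0, hn⟩ - (n : ℤ))) ∧
    (∀ k : ℤ,
      MonotoneTriangle.alpha n
          (fun i => if (i : ℕ) + 1 < n then ((i : ℕ) : ℤ) + 1 else -k) =
        (-1) ^ (n - 1) *
          MonotoneTriangle.alpha n
            (fun i => if (i : ℕ) + 1 < n then ((i : ℕ) : ℤ) + 1 else k)) := by
  obtain ⟨m, rfl⟩ : ∃ m, n = m + 1 := ⟨n - 1, by omega⟩
  refine ⟨fun k => MonotoneTriangle.alpha_rotate m k, fun k => ?_⟩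
  -- `(1, …, n-1, -k)` reflects to `(k, -(n-1), …, -1)` and rotates to `(-(n-1), …, -1, k-n)`;
  -- adding `n` gives `(1, …, n-1, k)`.
  rw [MonotoneTriangle.alpha_reflect, MonotoneTriangle.alpha_rotate,
    ← MonotoneTriangle.alpha_add_natCast _ (m + 1), Nat.add_sub_cancel]
  congr 2
  ext i
  have hi := i.isLt
  by_cases h : (i : ℕ) + 1 < m + 1
  · simp only [h, dif_pos, if_pos, Fin.val_rev]
    rw [if_pos (by omega)]
    omega
  · simp only [h, dif_neg, if_neg, Fin.val_rev, not_false_eq_true]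
    simp
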